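/- **Setting.** Curves and arcs are continuous. Two parametrized arcs *cross transversally* at a common point if both are injective near it and some homeomorphism from a neighbourhood of the point onto an open subset of $\mathbb R^2$ carries them, near the point, into the first and the second coordinate axis, respectively. A *generic closed plane curve* is a locally injective continuous map $\gamma:S^1\to\mathbb R^2$ whose only self-intersections are finitely many transversal double points (regular smooth immersions with transversal double points are examples). Its *Gauss diagram* $\mathfrak G(\gamma)$ is the oriented circle $S^1=\mathbb R/\mathbb Z$ together with a chord joining $x\ne y$ whenever $\gamma(x)=\gamma(y)$. Two such diagrams are regarded as equal if an orientation-preserving diffeomorphism of $S^1$ carries the chords of one onto the chords of the other. **Diagram of a permutation.** For $\pi\in\mathfrak S_N$ put $R(\pi)=\{(i,j): i<j,\ \pi(i)>\pi(j)\}$ and $\neg R(\pi)=R(\omega\pi)=\{(i,j): i<j,\ \pi(i)<\pi(j)\}$, where $\omega(i)=N+1-i$. Represent $\neg R(\pi)$ by intervals $\ell_1,\dots,\ell_N$ in a disc, $\ell_i$ joining the $i$-th point of a top row to the $\omega\pi(i)$-th point of a bottom row (both rows numbered from left to right), so that for $i<j$ the intervals $\ell_i,\ell_j$ cross iff $(i,j)\in\neg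 R(\pi)$; add an interval $\ell_0$ running from left to right between the two rows, which crosses all the others. The Gauss diagram $\mathfrak G(\pi)$ has the $N+1$ chords $\ell_0,\dots,\ell_N$; in the cyclic order of the oriented boundary circle their endpoints are: the left end of $\ell_0$, the top row from left to right, the right end of $\ell_0$, the bottom row from right to left. **Meanders.** A *closed meander* of order $2n$ ($n\ge 1$) is an oriented simple closed curve in $\mathbb R^2$ that meets the horizontal line $\mathbb R^1$ (oriented from left to right) in exactly $2n$ points, transversally, labelled $1,\dots,2n$ from left to right, and that is directed from top to bottom at point $1$. Its *meandric permutation* $\mu\in\mathfrak S_{2n}$, with $\mu(1)=1$, is such that the curve, followed once around from point $1$, passes successively through the points labelled $\mu(1),\mu(2),\dots,\mu(2n)$. **The curve $\widetilde\mu$.** Let $[a,b]\subset\mathbb R^1$ contain all the intersection points in its interior. Cut the meander on the part that leads from above the line down to point $1$; this leaves an arc from an endpoint $m$, just before point $1$, through all $2n$ intersection points to an endpoint $m'$, and the removed piece lies above the line. Join $m$ to $b$ by a simple arc $I$ and $m'$ to $a$ by a simple arc $J$, such that $I$ and $J$ meet the cut meander and $[a,b]$ only at their own endpoints, and meet each other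 in exactly one point, where they cross transversally. The closed curve $\widetilde\mu$ runs along $[a,b]$ from $a$ to $b$, along $I$ from $b$ to $m$, along the cut meander from $m$ to $m'$, and along $J$ from $m'$ back to $a$. **Proposition.** For every closed meander with meandric permutation $\mu$, every such curve $\widetilde\mu$ is a generic closed plane curve, and $\mathfrak G(\mu)=\mathfrak G(\widetilde\mu)$. -/

import Mathlib

open Set Filter Topology
open scoped ContDiff

/-! ### Permutations, the sets `R(π)` and `¬R(π)` -/

/-- `R(π) = {(i, j) : i < j, π(i) > π(j)}`. -/
def invSet {n : ℕ} (π : Equiv.Perm (Fin n)) : Set (Fin n × Fin n) :=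
  {p | p.1 < p.2 ∧ π p.2 < π p.1}

/-- `¬R(π) = R(ω π)`, where `ω` is the order reversing permutation. -/
def negInvSet {n : ℕ} (π : Equiv.Perm (Fin n)) : Set (Fin n × Fin n) :=
  invSet (Fin.revPerm * π)

theorem mem_negInvSet {n : ℕ} (π : Equiv.Perm (Fin n)) (i j : Fin n) :
    (i, j) ∈ negInvSet π ↔ i < j ∧ π i < π j := by
  simp [negInvSet, invSet]

/-! ### Gauss diagrams on the oriented circle `ℝ/ℤ` -/

/-- A chord diagram on the oriented circle `ℝ/ℤ`, given by its set of chords; a chord is the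
unordered pair of its endpoints. -/
abbrev ChordDiagram : Type := Set (Sym2 (AddCircle (1 : ℝ)))

/-- `f` is an orientation-preserving diffeomorphism of the circle: it lifts to a smooth map of the
real line with everywhere positive derivative. -/
def IsOrientationPreservingDiffeo (f : AddCircle (1 : ℝ) ≃ₜ AddCircle (1 : ℝ)) : Prop :=
  ∃ F : ℝ → ℝ, ContDiff ℝ ∞ F ∧ (∀ x, 0 < deriv F x) ∧
    ∀ x : ℝ, f (x : AddCircle (1 : ℝ)) = (F x : AddCircle (1 : ℝ))

/-- Two chord diagrams are not distinguished when an orientation-preserving diffeomorphism of the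
circle carries the chords of one onto the chords of the other. -/
def ChordDiagram.Equivalent (C D : ChordDiagram) : Prop :=
  ∃ f : AddCircle (1 : ℝ) ≃ₜ AddCircle (1 : ℝ),
    IsOrientationPreservingDiffeo f ∧ Sym2.map f '' C = D

/-- The Gauss diagram of a closed plane curve: two distinct points of the circle are joined by a
chord exactly when the curve maps them to the same point. -/
def gaussDiagram (γ : AddCircle (1 : ℝ) → ℝ × ℝ) : ChordDiagram :=
  {c | ∃ x y : AddCircle (1 : ℝ), x ≠ y ∧ γ x = γ y ∧ c = s(x, y)}

/-! ### The Gauss diagram of a permutation -/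

/-- The chords of the Gauss diagram of `π`, with endpoints given as places among the `2n + 2`
places `0, 1, …, 2n + 1` in cyclic order around the boundary of the disc.

The intervals `ℓ_i` representing `¬R(π) = R(ω π)` join the `i`-th point of a top row to the
`(ω π)(i)`-th point of a bottom row, both rows being numbered from left to right. The extra interval
`ℓ_0` (the chord `none`) runs from left to right between the rows. Going around the disc from the
left end of `ℓ_0` one meets: the left end of `ℓ_0` (place `0`), the top row from left to right
(places `1, …, n`), the right end of `ℓ_0` (place `n + 1`), and the bottom row from right to left
(places `n + 2, …, 2n + 1`). -/
def permChord {n : ℕ} (π : Equiv.Perm (Fin n)) : Option (Fin n) → ℕ × ℕ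
  | none => (0, n + 1)
  | some i => ((i : ℕ) + 1, 2 * n + 1 - ((Fin.revPerm (π i) : Fin n) : ℕ))

/-- Two chords, each given by its two places in increasing order, cross. -/
def ChordsCross (p q : ℕ × ℕ) : Prop :=
  (p.1 < q.1 ∧ q.1 < p.2 ∧ p.2 < q.2) ∨ (q.1 < p.1 ∧ p.1 < q.2 ∧ q.2 < p.2)

theorem permChord_none_cross {n : ℕ} (π : Equiv.Perm (Fin n)) (i : Fin n) :
    ChordsCross (permChord π none) (permChord π (some i)) := by
  have := i.isLt
  have := (Fin.revPerm (π i)).isLt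
  simp only [ChordsCross, permChord]
  omega

theorem permChord_some_cross {n : ℕ} (π : Equiv.Perm (Fin n)) (i j : Fin n) (hij : i < j) :
    ChordsCross (permChord π (some i)) (permChord π (some j)) ↔ (i, j) ∈ negInvSet π := by
  have h1 := i.isLt
  have h2 := j.isLt
  have h3 := (Fin.revPerm (π i)).isLt
  have h4 := (Fin.revPerm (π j)).isLt
  simp only [ChordsCross, permChord, negInvSet, invSet, Set.mem_ofPred_eq, Fin.lt_def,
    Equiv.Perm.mul_apply] at *
  omega

/-- The `k`-th of `m` equally spaced points of the circle. -/
noncomputable def circlePlace (m k : ℕ) : AddCircle (1 : ℝ) := (((k : ℝ) / (m : ℝ) : ℝ))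

/-- The Gauss diagram `𝔊(π)` of a permutation. -/
noncomputable def permGaussDiagram {n : ℕ} (π : Equiv.Perm (Fin n)) : ChordDiagram :=
  Set.range fun o : Option (Fin n) =>
    s(circlePlace (2 * n + 2) (permChord π o).1, circlePlace (2 * n + 2) (permChord π o).2)

/-! ### Transversality and generic curves -/

/-- The parametrized curve `α` at time `s` and the parametrized curve `β` at time `t` pass through
the same point and cross there transversally: both are locally injective, and some local
homeomorphism of the plane straightens them simultaneously, sending `α` into the first and `β` into
the second coordinate axis. (Regular smooth arcs with linearly independent velocities cross in this
sense, and arcs with corners are allowed.) -/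
def CrossTransversally (α β : ℝ → ℝ × ℝ) (s t : ℝ) : Prop :=
  α s = β t ∧ (∃ U ∈ 𝓝 s, InjOn α U) ∧ (∃ V ∈ 𝓝 t, InjOn β V) ∧
    ∃ e : OpenPartialHomeomorph (ℝ × ℝ) (ℝ × ℝ), α s ∈ e.source ∧
      (∀ᶠ u in 𝓝 s, (e (α u)).2 = 0) ∧ (∀ᶠ v in 𝓝 t, (e (β v)).1 = 0)

/-- A generic closed plane curve: a (topological) immersion of the circle whose only
self-intersections are finitely many transversal double points. -/
structure IsGenericPlaneCurve (γ : AddCircle (1 : ℝ) → ℝ × ℝ) : Prop where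
  continuous : Continuous γ
  locally_injective : ∀ x, ∃ U ∈ 𝓝 x, InjOn γ U
  finite_double : {p | ∃ x y, x ≠ y ∧ γ x = p ∧ γ y = p}.Finite
  no_triple : ∀ x y z, γ x = γ y → γ y = γ z → x = y ∨ y = z ∨ x = z
  transversal : ∀ s t : ℝ, (s : AddCircle (1 : ℝ)) ≠ (t : AddCircle (1 : ℝ)) →
    γ s = γ t → CrossTransversally (fun u : ℝ => γ u) (fun u : ℝ => γ u) s t

/-! ### Closed meanders -/

/-- A closed meander of order `2n`, `n > 0`: an oriented simple closed curve which meets the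
horizontal axis (oriented from left to right) in `2n` points, transversally. The points are labelled
along the line from left to right (labels start at `0` here), and the curve is directed from top
to bottom at the first of them. -/
structure ClosedMeander (n : ℕ) where
  pos : 0 < n
  curve : AddCircle (1 : ℝ) → ℝ × ℝ
  continuous : Continuous curve
  injective : Function.Injective curve
  /-- the abscissae of the intersection points, in increasing order -/
  abscissa : Fin (2 * n) → ℝ
  strictMono : StrictMono abscissa
  mem_line_iff : ∀ x : ℝ, (x, 0) ∈ range curve ↔ x ∈ range abscissa
  transversal : ∀ x t : ℝ, curve t = (x, 0) →
    CrossTransversally (fun u : ℝ => (u, 0)) (fun u : ℝ => curve u) x t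
  directed_down : ∀ t : ℝ, curve t = (abscissa ⟨0, by omega⟩, 0) →
    (∀ᶠ u : ℝ in 𝓝[<] t, 0 < (curve u).2) ∧ (∀ᶠ u : ℝ in 𝓝[>] t, (curve u).2 < 0)

/-- The label of the first intersection point. -/
def ClosedMeander.first {n : ℕ} (M : ClosedMeander n) : Fin (2 * n) :=
  ⟨0, by have := M.pos; omega⟩

/-- `μ` is the meandric permutation of `M`: the curve, followed once around from the first
intersection point, passes successively through the intersection points labelled
`μ(0) = 0, μ(1), …, μ(2n - 1)`. -/
def ClosedMeander.HasPermutation {n : ℕ} (M : ClosedMeander n)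
    (μ : Equiv.Perm (Fin (2 * n))) : Prop :=
  μ M.first = M.first ∧
    ∃ τ : Fin (2 * n) → ℝ, StrictMono τ ∧ (∀ k, τ k < τ M.first + 1) ∧
      ∀ k, M.curve (τ k) = (M.abscissa (μ k), 0)

/-! ### The closed curve of a meander -/

/-- The closed curve `γ` arises from the meander `M` by cutting `M` just before its first
intersection point with the line and joining the two ends to the ends of a segment of the line.

* The segment `[a, b]` of the line contains all intersection points in its interior.
* The meander is cut above the line, on the part which leads down to the first intersection point;
  what is left is the part of `M` between the times `s₀` and `s₁`, with end points `m = M(s₀)` and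
  `m' = M(s₁)`.
* `γ` goes along the segment from `a` to `b` (times `t₀` to `t₁`), along the interval `I` from `b`
  to `m` (times `t₁` to `t₂`), along the cut meander from `m` to `m'` (times `t₂` to `t₃`), and along
  the interval `J` from `m'` to `a` (times `t₃` to `t₀ + 1`).
* `I` and `J` are simple arcs which meet the segment and the cut meander only at their own end
  points, and which meet each other in a single point, where they cross. -/
def ClosedMeander.IsClosure {n : ℕ} (M : ClosedMeander n)
    (γ : AddCircle (1 : ℝ) → ℝ × ℝ) : Prop :=
  Continuous γ ∧
  ∃ a b s₀ s₁ t₀ t₁ t₂ t₃ : ℝ,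
    -- the segment
    (∀ i, a < M.abscissa i ∧ M.abscissa i < b) ∧
    -- the cut
    s₀ < s₁ ∧ s₁ < s₀ + 1 ∧
    (∀ s ∈ Icc s₁ (s₀ + 1), 0 < (M.curve (s : ℝ)).2) ∧
    (∃ c ∈ Ioo s₀ s₁, M.curve (c : ℝ) = (M.abscissa M.first, 0) ∧
      ∀ s ∈ Ico s₀ c, 0 < (M.curve (s : ℝ)).2) ∧
    -- the order of the four pieces
    t₀ < t₁ ∧ t₁ < t₂ ∧ t₂ < t₃ ∧ t₃ < t₀ + 1 ∧
    -- the piece along the segment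
    γ t₀ = (a, 0) ∧ γ t₁ = (b, 0) ∧
    (∀ t ∈ Icc t₀ t₁, (γ (t : ℝ)).2 = 0) ∧
    StrictMonoOn (fun t : ℝ => (γ t).1) (Icc t₀ t₁) ∧
    -- the piece along the cut meander
    (∃ φ : ℝ → ℝ, ContinuousOn φ (Icc t₂ t₃) ∧ StrictMonoOn φ (Icc t₂ t₃) ∧
      φ t₂ = s₀ ∧ φ t₃ = s₁ ∧ ∀ t ∈ Icc t₂ t₃, γ (t : ℝ) = M.curve (φ t : ℝ)) ∧
    -- the intervals `I` and `J`
    InjOn (fun t : ℝ => γ t) (Icc t₁ t₂) ∧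
    InjOn (fun t : ℝ => γ t) (Icc t₃ (t₀ + 1)) ∧
    (∀ t ∈ Ioo t₁ t₂ ∪ Ioo t₃ (t₀ + 1),
      (∀ x ∈ Icc a b, γ (t : ℝ) ≠ (x, 0)) ∧ ∀ s ∈ Icc s₀ s₁, γ (t : ℝ) ≠ M.curve (s : ℝ)) ∧
    -- the new intersection point
    (∃ u ∈ Ioo t₁ t₂, ∃ v ∈ Ioo t₃ (t₀ + 1),
      CrossTransversally (fun t : ℝ => γ t) (fun t : ℝ => γ t) u v ∧
      ∀ u' ∈ Icc t₁ t₂, ∀ v' ∈ Icc t₃ (t₀ + 1), γ (u' : ℝ) = γ (v' : ℝ) → u' = u ∧ v' = v)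

/-! The closure has only two kinds of double points: the crossing of `I` with `J`, and the points
where the segment meets the cut meander. Reading them off from the crossing on `I`, the curve first
passes the intersection points in the meander's order `μ(0), μ(1), …`, then the crossing on `J`,
then the same intersection points from left to right along the segment. So the `k`-th passage of the
meander is paired with the `μ(k)`-th point of the segment. In the diagram of `μ` the reversal `ω`
cancels against the right-to-left reading of the bottom row, which gives the same pairing, with
`ℓ_0` in the role of the crossing of `I` and `J`. No further planar topology enters.

Equality of cyclic orders becomes equality of diagrams through `exists_diffeo_circlePlace`.
Genericity follows from the list of chords alone (`IsGenericPlaneCurve.of_chords`), corners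
included: finitely many chords with distinct ends exclude triple points and force local injectivity.
`generic_and_gaussDiagram_of_times` combines the two, and `crossingTime` supplies the ordered list
of times. -/

/-! ### Circle diffeomorphisms through prescribed points -/

/-- A homeomorphism of the circle obtained from a smooth degree one lift with positive derivative. -/
theorem exists_circle_homeomorph_of_lift (F : ℝ → ℝ) (hF : ContDiff ℝ ∞ F)
    (hpos : ∀ x, 0 < deriv F x) (hper : ∀ x, F (x + 1) = F x + 1) :
    ∃ f : AddCircle (1 : ℝ) ≃ₜ AddCircle (1 : ℝ),
      IsOrientationPreservingDiffeo f ∧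
        ∀ x : ℝ, f (x : AddCircle (1 : ℝ)) = (F x : AddCircle (1 : ℝ)) := by
  have hmono : StrictMono F := strictMono_of_deriv_pos hpos
  -- Degree one gives the limits at both infinities, hence surjectivity.
  let L : CircleDeg1Lift := ⟨⟨F, hmono.monotone⟩, hper⟩
  have hsurj : Function.Surjective F :=
    hF.continuous.surjective L.tendsto_atTop L.tendsto_atBot
  let E : ℝ ≃ₜ ℝ := (hmono.orderIsoOfSurjective F hsurj).toHomeomorph
  have hE : ∀ x, E x = F x := fun x => rfl
  have hEs : ∀ x, E.symm (x + 1) = E.symm x + 1 := fun x => by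
    rw [E.symm_apply_eq, hE, hper, ← hE, E.apply_symm_apply]
  have hlift : ∀ G : ℝ → ℝ, Continuous G → (∀ x, G (x + 1) = G x + 1) →
      ∃ g : AddCircle (1 : ℝ) → AddCircle (1 : ℝ), Continuous g ∧
        ∀ x : ℝ, g (x : AddCircle (1 : ℝ)) = (G x : AddCircle (1 : ℝ)) := by
    intro G hG hGp
    have hp : Function.Periodic (fun x => (G x : AddCircle (1 : ℝ))) 1 := fun x => by
      simp only [hGp, AddCircle.coe_add, AddCircle.coe_period, add_zero]
    refine ⟨hp.lift, ?_, fun x => rfl⟩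
    exact Continuous.quotient_lift ((AddCircle.continuous_mk' 1).comp hG) _
  obtain ⟨g, hg, hg'⟩ := hlift F hF.continuous hper
  obtain ⟨k, hk, hk'⟩ := hlift E.symm E.symm.continuous hEs
  refine ⟨⟨⟨g, k, fun x => ?_, fun x => ?_⟩, hg, hk⟩, ⟨F, hF, hpos, hg'⟩, hg'⟩
  · induction x using QuotientAddGroup.induction_on with
    | H x => exact (congrArg k (hg' x)).trans ((hk' _).trans (by rw [← hE, E.symm_apply_apply]))
  · induction x using QuotientAddGroup.induction_on with
    | H x => exact (congrArg g (hk' x)).trans ((hg' _).trans (by rw [← hE, E.apply_symm_apply]))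

/-- The smooth `1`-periodic bump which is positive exactly within `1 / (2 m)` of the centre `z`,
modulo `1`. -/
noncomputable def circleBump (m : ℕ) (z x : ℝ) : ℝ :=
  expNegInvGlue (Real.cos (2 * Real.pi * (x - z)) - Real.cos (Real.pi / m))

theorem circleBump_contDiff (m : ℕ) (z : ℝ) : ContDiff ℝ ∞ (circleBump m z) := by
  unfold circleBump
  exact expNegInvGlue.contDiff.comp
    ((Real.contDiff_cos.comp (contDiff_const.mul (contDiff_id.sub contDiff_const))).sub
      contDiff_const)

theorem circleBump_nonneg (m : ℕ) (z x : ℝ) : 0 ≤ circleBump m z x := expNegInvGlue.nonneg _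

theorem circleBump_add_one (m : ℕ) (z x : ℝ) : circleBump m z (x + 1) = circleBump m z x := by
  unfold circleBump
  rw [show 2 * Real.pi * (x + 1 - z) = 2 * Real.pi * (x - z) + 2 * Real.pi by ring,
    Real.cos_add_two_pi]

theorem circleBump_pos {m : ℕ} (hm : 0 < m) {z x : ℝ} (h : |x - z| < 1 / (2 * m)) :
    0 < circleBump m z x := by
  have hm' : (1 : ℝ) ≤ m := by exact_mod_cast hm
  have hpi := Real.pi_pos
  refine expNegInvGlue.pos_of_pos (sub_pos.2 ?_)
  rw [← Real.cos_abs (2 * Real.pi * (x - z)), abs_mul, abs_of_pos (by positivity)]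
  apply Real.cos_lt_cos_of_nonneg_of_le_pi (by positivity)
  · exact div_le_self hpi.le hm'
  · calc 2 * Real.pi * |x - z| < 2 * Real.pi * (1 / (2 * m)) := by gcongr
      _ = Real.pi / m := by field_simp

/-- The upper bound `h₂` is needed because the bump reappears, by periodicity, around `z ± 1`. -/
theorem circleBump_eq_zero {m : ℕ} (hm : 0 < m) {z x : ℝ} (h₁ : 1 / (2 * m) ≤ |x - z|)
    (h₂ : |x - z| ≤ 1 - 1 / (2 * m)) : circleBump m z x = 0 := by
  have hm' : (1 : ℝ) ≤ m := by exact_mod_cast hm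
  have hpi := Real.pi_pos
  refine expNegInvGlue.zero_of_nonpos (sub_nonpos.2 ?_)
  rw [← Real.cos_abs (2 * Real.pi * (x - z)), abs_mul, abs_of_pos (by positivity : 0 < 2 * Real.pi)]
  have e₁ : Real.pi / m = 2 * Real.pi * (1 / (2 * m)) := by field_simp
  rcases le_total |x - z| (1 / 2) with h | h
  · apply Real.cos_le_cos_of_nonneg_of_le_pi (by positivity) (by nlinarith)
    rw [e₁]; gcongr
  -- Past half a turn the angle is reflected into `[0, π]`, where cosine is antitone.
  · rw [← Real.cos_two_pi_sub]
    apply Real.cos_le_cos_of_nonneg_of_le_pi (by positivity) (by nlinarith)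
    rw [e₁]; nlinarith

/-- Points in cyclic order on the circle are the images of equally spaced points under an
orientation-preserving diffeomorphism. -/
theorem exists_diffeo_circlePlace {m : ℕ} (hm : 0 < m) (p : ℕ → ℝ)
    (hp : ∀ k < m, p k < p (k + 1)) (hpm : p m = p 0 + 1) :
    ∃ f : AddCircle (1 : ℝ) ≃ₜ AddCircle (1 : ℝ), IsOrientationPreservingDiffeo f ∧
      ∀ k < m, f (circlePlace m k) = (p k : AddCircle (1 : ℝ)) := by
  have hm' : (0 : ℝ) < m := by exact_mod_cast hm
  obtain ⟨ε, hε, hεp⟩ : ∃ ε : ℝ, 0 < ε ∧ ∀ k ∈ Finset.range m, ε / m ≤ p (k + 1) - p k := by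
    obtain ⟨k₀, hk₀, hmin⟩ := Finset.exists_min_image (Finset.range m)
      (fun k => p (k + 1) - p k) ⟨0, by simpa using hm⟩
    -- With this `ε`, a constant density `ε` uses up on each cell exactly the smallest gap, so the
    -- coefficients `c k` below are nonnegative.
    refine ⟨m * (p (k₀ + 1) - p k₀),
      mul_pos hm' (sub_pos.2 (hp _ (Finset.mem_range.1 hk₀))), fun k hk => ?_⟩
    rw [mul_div_cancel_left₀ _ hm'.ne']
    exact hmin k hk
  let z : ℕ → ℝ := fun k => (k + 1 / 2) / m
  let H : ℕ → ℝ := fun k => ∫ x in ((k : ℝ) / m)..((k + 1 : ℕ) / m), circleBump m (z k) x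
  have hlt : ∀ k : ℕ, (k : ℝ) / m < ((k + 1 : ℕ) : ℝ) / m := fun k => by
    gcongr; exact_mod_cast k.lt_succ_self
  have hH : ∀ k, 0 < H k := fun k => by
    refine intervalIntegral.intervalIntegral_pos_of_pos_on
      ((circleBump_contDiff m (z k)).continuous.intervalIntegrable _ _) (fun x hx => ?_) (hlt k)
    apply circleBump_pos hm
    have h1 : (k : ℝ) / m = z k - 1 / (2 * m) := by simp only [z]; field_simp; ring
    have h2 : ((k + 1 : ℕ) : ℝ) / m = z k + 1 / (2 * m) := by
      simp only [z]; push_cast; field_simp; ring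
    rw [abs_lt]
    constructor <;> linarith [hx.1, hx.2]
  -- On the `k`-th cell only the `k`-th bump is nonzero; `c k` makes the integral of `g` over that
  -- cell the gap `p (k + 1) - p k`.
  let c : ℕ → ℝ := fun k => (p (k + 1) - p k - ε / m) / H k
  let g : ℝ → ℝ := fun x => ε + ∑ k ∈ Finset.range m, c k * circleBump m (z k) x
  have hgc : ContDiff ℝ ∞ g :=
    contDiff_const.add (ContDiff.sum fun k _ => contDiff_const.mul (circleBump_contDiff m (z k)))
  have hgi : ∀ a b, IntervalIntegrable g MeasureTheory.volume a b :=
    fun a b => hgc.continuous.intervalIntegrable a b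
  have hgpos : ∀ x, 0 < g x := fun x =>
    add_pos_of_pos_of_nonneg hε (Finset.sum_nonneg fun k hk =>
      mul_nonneg (div_nonneg (sub_nonneg.2 (hεp k hk)) (hH k).le) (circleBump_nonneg _ _ _))
  have hgper : Function.Periodic g 1 := fun x => by
    simp only [g, circleBump_add_one]
  let F : ℝ → ℝ := fun x => p 0 + ∫ y in (0 : ℝ)..x, g y
  have hstep : ∀ k < m, ∫ x in ((k : ℝ) / m)..((k + 1 : ℕ) / m), g x = p (k + 1) - p k := by
    intro k hk
    have hg1 : EqOn g (fun x => ε + c k * circleBump m (z k) x)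
        (uIcc ((k : ℝ) / m) (((k + 1 : ℕ) : ℝ) / m)) := by
      intro x hx
      rw [uIcc_of_le (hlt k).le] at hx
      simp only [g]
      congr 1
      refine Finset.sum_eq_single k (fun j hj hjk => ?_)
        (fun h => absurd (Finset.mem_range.2 hk) h)
      have hjm := Finset.mem_range.1 hj
      rw [circleBump_eq_zero hm, mul_zero]
      all_goals
        have hx1 : (k : ℝ) ≤ x * m := (div_le_iff₀ hm').1 hx.1
        have hx2 : x * m ≤ (k : ℝ) + 1 := by
          have := (le_div_iff₀ hm').1 hx.2
          push_cast at this; exact this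
        have hkm : (k : ℝ) + 1 ≤ m := by exact_mod_cast hk
        have hjm' : (j : ℝ) + 1 ≤ m := by exact_mod_cast hjm
        have hk0 : (0 : ℝ) ≤ k := by positivity
        have hj0 : (0 : ℝ) ≤ j := by positivity
        have hxz : x - z j = (x * m - (j + 1 / 2)) / m := by simp only [z]; field_simp
        rw [hxz, abs_div, abs_of_pos hm']
      · rw [show (1 : ℝ) / (2 * m) = (1 / 2) / m by field_simp]
        gcongr
        rcases lt_or_gt_of_ne hjk with h | h
        · have : (j : ℝ) + 1 ≤ k := by exact_mod_cast h
          exact le_abs.2 (Or.inl (by linarith))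
        · have : (k : ℝ) + 1 ≤ j := by exact_mod_cast h
          exact le_abs.2 (Or.inr (by linarith))
      · rw [div_le_iff₀ hm', show (1 - 1 / (2 * (m : ℝ))) * m = m - 1 / 2 by field_simp]
        rw [abs_le]
        constructor <;> linarith
    have hbi : IntervalIntegrable (fun x => c k * circleBump m (z k) x) MeasureTheory.volume
        ((k : ℝ) / m) (((k + 1 : ℕ) : ℝ) / m) :=
      (continuous_const.mul (circleBump_contDiff m (z k)).continuous).intervalIntegrable _ _
    rw [intervalIntegral.integral_congr hg1, intervalIntegral.integral_add
      (continuous_const.intervalIntegrable _ _) hbi,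
      intervalIntegral.integral_const_mul, intervalIntegral.integral_const]
    change _ + c k * H k = _
    simp only [c]
    rw [div_mul_cancel₀ _ (hH k).ne', smul_eq_mul]
    push_cast
    field_simp
    ring
  have hFk : ∀ k ≤ m, F (k / m) = p k := by
    intro k
    induction k with
    | zero => intro _; simp [F]
    | succ k ih =>
      intro hk
      have h1 := ih (by omega)
      have h2 := hstep k (by omega)
      have h3 := intervalIntegral.integral_add_adjacent_intervals (hgi 0 ((k : ℝ) / m))
        (hgi _ (((k + 1 : ℕ) : ℝ) / m))
      simp only [F] at h1 ⊢
      linarith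
  have hF1 : F 1 = p 0 + 1 := by
    have := hFk m le_rfl
    rwa [div_self hm'.ne', hpm] at this
  have hderiv : ∀ x, HasDerivAt F (g x) x := fun x =>
    (intervalIntegral.integral_hasDerivAt_right (hgi 0 x)
      (hgc.continuous.stronglyMeasurableAtFilter _ _) hgc.continuous.continuousAt).const_add _
  have hd : deriv F = g := funext fun x => (hderiv x).deriv
  obtain ⟨f, hf, hf'⟩ := exists_circle_homeomorph_of_lift F
    (contDiff_infty_iff_deriv.2 ⟨fun x => (hderiv x).differentiableAt, by rwa [hd]⟩)
    (fun x => by rw [hd]; exact hgpos x) (fun x => by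
      have h3 := intervalIntegral.integral_add_adjacent_intervals (hgi 0 x) (hgi x (x + 1))
      have h4 := hgper.intervalIntegral_add_eq x 0
      simp only [F, zero_add] at h3 h4 hF1 ⊢
      linarith)
  exact ⟨f, hf, fun k hk => (hf' _).trans (by rw [hFk k hk.le])⟩

/-! ### Lifts to the real line and transversal crossings -/

theorem AddCircle.coe_eq_coe_iff_exists_int {x y : ℝ} :
    (x : AddCircle (1 : ℝ)) = (y : AddCircle (1 : ℝ)) ↔ ∃ k : ℤ, y = x + k := by
  rw [eq_comm, ← sub_eq_zero, ← AddCircle.coe_sub, AddCircle.coe_eq_zero_iff]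
  constructor
  · rintro ⟨k, hk⟩
    refine ⟨k, ?_⟩
    rw [zsmul_eq_mul, mul_one] at hk
    linarith
  · rintro ⟨k, hk⟩
    refine ⟨k, ?_⟩
    rw [zsmul_eq_mul, mul_one]
    linarith

theorem AddCircle.coe_inj_of_lt_add_one {x y : ℝ}
    (h : (x : AddCircle (1 : ℝ)) = (y : AddCircle (1 : ℝ))) (h₁ : y < x + 1) (h₂ : x < y + 1) :
    x = y := by
  obtain ⟨k, rfl⟩ := AddCircle.coe_eq_coe_iff_exists_int.1 h
  have h3 : k < 1 := by exact_mod_cast (by linarith : (k : ℝ) < 1)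
  have h4 : -1 < k := by exact_mod_cast (by linarith : (-1 : ℝ) < k)
  obtain rfl : k = 0 := by omega
  simp

/-- The straightening chart is composed with the swap of the two coordinates. -/
theorem CrossTransversally.symm {α β : ℝ → ℝ × ℝ} {s t : ℝ} (h : CrossTransversally α β s t) :
    CrossTransversally β α t s := by
  obtain ⟨h0, hα, hβ, e, he, h1, h2⟩ := h
  refine ⟨h0.symm, hβ, hα, e.trans (Homeomorph.prodComm ℝ ℝ).toOpenPartialHomeomorph, ?_, ?_, ?_⟩
  · simpa [← h0] using he
  · simpa using h2
  · simpa using h1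

/-- Transversal crossing is invariant under local reparametrization. -/
theorem CrossTransversally.reparam {α β α' β' : ℝ → ℝ × ℝ} {s t s' t' : ℝ} {f g : ℝ → ℝ}
    (h : CrossTransversally α β s t)
    (hf : ContinuousAt f s') (hfs : f s' = s) (hfi : ∃ U ∈ 𝓝 s', InjOn f U)
    (hα : α' =ᶠ[𝓝 s'] α ∘ f)
    (hg : ContinuousAt g t') (hgt : g t' = t) (hgi : ∃ U ∈ 𝓝 t', InjOn g U)
    (hβ : β' =ᶠ[𝓝 t'] β ∘ g) : CrossTransversally α' β' s' t' := by
  have key : ∀ {α α' : ℝ → ℝ × ℝ} {s s' : ℝ} {f : ℝ → ℝ}, ContinuousAt f s' → f s' = s →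
      (∃ U ∈ 𝓝 s', InjOn f U) → α' =ᶠ[𝓝 s'] α ∘ f → (∃ U ∈ 𝓝 s, InjOn α U) →
      ∃ U ∈ 𝓝 s', InjOn α' U := by
    intro α α' s s' f hf hfs ⟨U, hU, hUi⟩ hα ⟨V, hV, hVi⟩
    refine ⟨{x | α' x = (α ∘ f) x} ∩ (U ∩ f ⁻¹' V),
      inter_mem hα (inter_mem hU (hf (by rwa [hfs]))), ?_⟩
    intro x hx y hy hxy
    refine hUi hx.2.1 hy.2.1 (hVi hx.2.2 hy.2.2 ?_)
    have h1 : α' x = α (f x) := hx.1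
    have h2 : α' y = α (f y) := hy.1
    rw [← h1, ← h2, hxy]
  obtain ⟨h0, hαi, hβi, e, he, h1, h2⟩ := h
  have e1 : α' s' = α s := by rw [hα.eq_of_nhds, Function.comp_apply, hfs]
  have e2 : β' t' = β t := by rw [hβ.eq_of_nhds, Function.comp_apply, hgt]
  refine ⟨by rw [e1, e2, h0], key hf hfs hfi hα hαi, key hg hgt hgi hβ hβi, e, by rwa [e1], ?_, ?_⟩
  · filter_upwards [hα, hf.eventually (by rw [hfs]; exact h1)] with u hu hu'
    rw [hu]; exact hu'
  · filter_upwards [hβ, hg.eventually (by rw [hgt]; exact h2)] with u hu hu'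
    rw [hu]; exact hu'

/-- On the circle, transversal crossing does not depend on the chosen lifts of the two times. -/
theorem CrossTransversally.of_coe_eq {γ : AddCircle (1 : ℝ) → ℝ × ℝ} {s t s' t' : ℝ}
    (h : CrossTransversally (fun u : ℝ => γ u) (fun u : ℝ => γ u) s t)
    (hs : (s' : AddCircle (1 : ℝ)) = s) (ht : (t' : AddCircle (1 : ℝ)) = t) :
    CrossTransversally (fun u : ℝ => γ u) (fun u : ℝ => γ u) s' t' := by
  obtain ⟨k, rfl⟩ := AddCircle.coe_eq_coe_iff_exists_int.1 hs
  obtain ⟨l, rfl⟩ := AddCircle.coe_eq_coe_iff_exists_int.1 ht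
  have hper : ∀ (k : ℤ) (u : ℝ), γ (u : ℝ) = γ ((u + k : ℝ)) := fun k u =>
    congrArg γ (AddCircle.coe_eq_coe_iff_exists_int.2 ⟨k, rfl⟩)
  exact h.reparam (f := fun u => u + (k : ℝ)) (g := fun u => u + (l : ℝ))
    (by fun_prop) rfl ⟨univ, univ_mem, (add_left_injective _).injOn⟩
    (Eventually.of_forall fun u => hper k u)
    (by fun_prop) rfl ⟨univ, univ_mem, (add_left_injective _).injOn⟩
    (Eventually.of_forall fun u => hper l u)

/-! ### Closed curves with prescribed chords -/

/-- A closed curve with finitely many chords, no two of which share an end point, and which crosses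
itself transversally along each of them, is generic. -/
theorem IsGenericPlaneCurve.of_chords {ι : Type*} [Finite ι] {γ : AddCircle (1 : ℝ) → ℝ × ℝ}
    (hγ : Continuous γ) (e₁ e₂ : ι → ℝ)
    (h₁ : ∀ i j, (e₁ i : AddCircle (1 : ℝ)) = e₁ j → i = j)
    (h₂ : ∀ i j, (e₂ i : AddCircle (1 : ℝ)) = e₂ j → i = j)
    (h₁₂ : ∀ i j, (e₁ i : AddCircle (1 : ℝ)) ≠ e₂ j)
    (hchord : gaussDiagram γ =
      range fun i => s((e₁ i : AddCircle (1 : ℝ)), (e₂ i : AddCircle (1 : ℝ))))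
    (hcross : ∀ i, CrossTransversally (fun u : ℝ => γ u) (fun u : ℝ => γ u) (e₁ i) (e₂ i)) :
    IsGenericPlaneCurve γ := by
  have hmem : ∀ x y : AddCircle (1 : ℝ), x ≠ y → γ x = γ y →
      ∃ i, (x = e₁ i ∧ y = e₂ i) ∨ (x = e₂ i ∧ y = e₁ i) := by
    intro x y hxy h
    have : s(x, y) ∈ gaussDiagram γ := ⟨x, y, hxy, h, rfl⟩
    rw [hchord] at this
    obtain ⟨i, hi⟩ := this
    rw [Sym2.eq_iff] at hi
    exact ⟨i, by tauto⟩
  have hfin : {q : AddCircle (1 : ℝ) × AddCircle (1 : ℝ) | q.1 ≠ q.2 ∧ γ q.1 = γ q.2}.Finite := by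
    refine ((finite_range fun i => ((e₁ i : AddCircle (1 : ℝ)), (e₂ i : AddCircle (1 : ℝ)))).union
      (finite_range fun i => ((e₂ i : AddCircle (1 : ℝ)), (e₁ i : AddCircle (1 : ℝ))))).subset ?_
    rintro ⟨x, y⟩ ⟨hxy, h⟩
    obtain ⟨i, ⟨rfl, rfl⟩ | ⟨rfl, rfl⟩⟩ := hmem x y hxy h
    · exact Or.inl ⟨i, rfl⟩
    · exact Or.inr ⟨i, rfl⟩
  refine ⟨hγ, fun x => ?_, ?_, ?_, ?_⟩
  -- The finite set of off-diagonal coincidences is closed and misses `(x, x)`, so some square `U ×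
  -- U` avoids it.
  · have hnhds := hfin.isClosed.isOpen_compl.mem_nhds (x := (x, x)) (by simp)
    rw [nhds_prod_eq, mem_prod_self_iff] at hnhds
    obtain ⟨U, hU, hUs⟩ := hnhds
    refine ⟨U, hU, fun y hy z hz hyz => ?_⟩
    by_contra hne
    exact hUs (mk_mem_prod hy hz) ⟨hne, hyz⟩
  · refine (hfin.image fun q => γ q.1).subset ?_
    rintro p ⟨x, y, hxy, rfl, h⟩
    exact ⟨(x, y), ⟨hxy, h.symm⟩, rfl⟩
  · intro x y z hxy hyz
    by_contra! hne
    obtain ⟨i, hi⟩ := hmem x y hne.1 hxy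
    obtain ⟨j, hj⟩ := hmem y z hne.2.1 hyz
    -- The point `y` is an end of both chords `i` and `j`; as ends are not shared, the chords agree
    -- and `x = z`.
    rcases hi with ⟨rfl, rfl⟩ | ⟨rfl, rfl⟩ <;> rcases hj with ⟨hj, rfl⟩ | ⟨hj, rfl⟩
    · exact h₁₂ _ _ hj.symm
    · obtain rfl := h₂ _ _ hj
      exact hne.2.2 rfl
    · obtain rfl := h₁ _ _ hj
      exact hne.2.2 rfl
    · exact h₁₂ _ _ hj
  · intro s t hst h
    obtain ⟨i, ⟨hs, ht⟩ | ⟨hs, ht⟩⟩ := hmem s t hst h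
    · exact (hcross i).of_coe_eq hs ht
    · exact (hcross i).symm.of_coe_eq hs ht

theorem permChord_fst_le {n : ℕ} (π : Equiv.Perm (Fin n)) (o : Option (Fin n)) :
    (permChord π o).1 ≤ n := by
  cases o with
  | none => simp [permChord]
  | some i => exact i.isLt

/-- The reversal `ω` and the right-to-left numbering of the bottom row cancel. -/
theorem permChord_some {n : ℕ} (π : Equiv.Perm (Fin n)) (i : Fin n) :
    permChord π (some i) = ((i : ℕ) + 1, n + 2 + (π i : ℕ)) := by
  have := (π i).isLt
  simp only [permChord, Fin.revPerm_apply, Fin.val_rev, Prod.mk.injEq, true_and]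
  omega

theorem permChord_snd_mem {n : ℕ} (π : Equiv.Perm (Fin n)) (o : Option (Fin n)) :
    n < (permChord π o).2 ∧ (permChord π o).2 < 2 * n + 2 := by
  cases o with
  | none => simp only [permChord]; omega
  | some i =>
    have := (π i).isLt
    rw [permChord_some]
    dsimp only
    omega

theorem permChord_fst_injective {n : ℕ} (π : Equiv.Perm (Fin n)) :
    Function.Injective fun o => (permChord π o).1 := by
  rintro (_ | i) (_ | j) h <;> simp [permChord] at h ⊢
  exact Fin.ext h

theorem permChord_snd_injective {n : ℕ} (π : Equiv.Perm (Fin n)) :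
    Function.Injective fun o => (permChord π o).2 := by
  have hn : (permChord π none).2 = n + 1 := rfl
  rintro (_ | i) (_ | j) h <;> simp only [permChord_some, hn] at h
  · rfl
  · omega
  · omega
  · rw [π.injective (Fin.ext (by omega : (π i : ℕ) = π j))]

theorem circlePlace_injOn (m : ℕ) : InjOn (circlePlace m) (Iio m) := by
  intro k hk l hl h
  have hk' : (k : ℝ) < m := by exact_mod_cast hk
  have hl' : (l : ℝ) < m := by exact_mod_cast hl
  have hm : (0 : ℝ) < m := lt_of_le_of_lt (by positivity) hk'
  have h1 : (k : ℝ) / m < 1 := (div_lt_one hm).2 hk'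
  have h2 : (l : ℝ) / m < 1 := (div_lt_one hm).2 hl'
  have h3 : 0 ≤ (k : ℝ) / m := by positivity
  have h4 : 0 ≤ (l : ℝ) / m := by positivity
  have := AddCircle.coe_inj_of_lt_add_one h (by linarith) (by linarith)
  rw [div_left_inj' hm.ne'] at this
  exact_mod_cast this

/-- A closed curve is generic, with the Gauss diagram of the permutation `π`, as soon as its
crossings occur at times in the cyclic order prescribed by `π`. -/
theorem generic_and_gaussDiagram_of_times {n : ℕ} (π : Equiv.Perm (Fin n))
    {γ : AddCircle (1 : ℝ) → ℝ × ℝ} (hγ : Continuous γ) (p : ℕ → ℝ)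
    (hp : ∀ k < 2 * n + 2, p k < p (k + 1)) (hpm : p (2 * n + 2) = p 0 + 1)
    (hcross : ∀ o, CrossTransversally (fun u : ℝ => γ u) (fun u : ℝ => γ u)
      (p (permChord π o).1) (p (permChord π o).2))
    (hdouble : ∀ x y : AddCircle (1 : ℝ), x ≠ y → γ x = γ y →
      ∃ o, s(x, y) = s((p (permChord π o).1 : AddCircle (1 : ℝ)),
        (p (permChord π o).2 : AddCircle (1 : ℝ)))) :
    IsGenericPlaneCurve γ ∧ ChordDiagram.Equivalent (permGaussDiagram π) (gaussDiagram γ) := by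
  obtain ⟨f, hf, hfp⟩ := exists_diffeo_circlePlace (by omega : 0 < 2 * n + 2) p hp hpm
  -- Distinctness of the times modulo `1` is inherited from the equally spaced points through `f`.
  have hinj : ∀ k l : ℕ, k < 2 * n + 2 → l < 2 * n + 2 →
      (p k : AddCircle (1 : ℝ)) = p l → k = l := by
    intro k l hk hl h
    rw [← hfp k hk, ← hfp l hl] at h
    exact circlePlace_injOn _ hk hl (f.injective h)
  have hfst : ∀ o, (permChord π o).1 < 2 * n + 2 := fun o => by
    have := permChord_fst_le π o
    omega
  have hsnd : ∀ o, (permChord π o).2 < 2 * n + 2 := fun o => (permChord_snd_mem π o).2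
  have hne : ∀ o o', (p (permChord π o).1 : AddCircle (1 : ℝ)) ≠ p (permChord π o').2 := by
    intro o o' h
    have h1 := hinj _ _ (hfst o) (hsnd o') h
    have h2 := permChord_fst_le π o
    have h3 := (permChord_snd_mem π o').1
    omega
  have hG : gaussDiagram γ = range fun o => s((p (permChord π o).1 : AddCircle (1 : ℝ)),
      (p (permChord π o).2 : AddCircle (1 : ℝ))) := by
    ext q
    constructor
    · rintro ⟨x, y, hxy, h, rfl⟩
      obtain ⟨o, ho⟩ := hdouble x y hxy h
      exact ⟨o, ho.symm⟩
    · rintro ⟨o, rfl⟩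
      exact ⟨_, _, hne o o, (hcross o).1, rfl⟩
  refine ⟨.of_chords hγ _ _
    (fun o o' h => permChord_fst_injective π (hinj _ _ (hfst o) (hfst o') h))
    (fun o o' h => permChord_snd_injective π (hinj _ _ (hsnd o) (hsnd o') h)) hne hG hcross,
    f, hf, ?_⟩
  rw [hG, permGaussDiagram, ← range_comp]
  congr 1
  funext o
  simp only [Function.comp_apply, Sym2.map_mk, hfp _ (hfst o), hfp _ (hsnd o)]

/-! ### Crossing times in cyclic order -/

/-- The passing times of a meander can be chosen within the cut meander, beginning at the time `c`
of the first intersection point. -/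
theorem ClosedMeander.HasPermutation.exists_times {n : ℕ} {M : ClosedMeander n}
    {μ : Equiv.Perm (Fin (2 * n))} (hμ : M.HasPermutation μ) {s₀ s₁ c : ℝ}
    (habove : ∀ s ∈ Icc s₁ (s₀ + 1), 0 < (M.curve (s : ℝ)).2) (hc : c ∈ Ioo s₀ s₁)
    (hcM : M.curve (c : ℝ) = (M.abscissa M.first, 0))
    (hbefore : ∀ s ∈ Ico s₀ c, 0 < (M.curve (s : ℝ)).2) :
    ∃ τ : Fin (2 * n) → ℝ, StrictMono τ ∧ (∀ k, τ k ∈ Ioo s₀ s₁) ∧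
      ∀ k, M.curve (τ k) = (M.abscissa (μ k), 0) := by
  obtain ⟨hμ0, τ, hτ, hτ1, hτM⟩ := hμ
  have h0 : M.curve (τ M.first) = M.curve (c : ℝ) := by rw [hτM, hμ0, hcM]
  -- The integer `l` moves the first passing time to `c`.
  obtain ⟨l, hl⟩ := AddCircle.coe_eq_coe_iff_exists_int.1 (M.injective h0)
  have hM : ∀ k, M.curve ((τ k + l : ℝ)) = (M.abscissa (μ k), 0) := fun k => by
    rw [← hτM]
    exact congrArg M.curve (AddCircle.coe_eq_coe_iff_exists_int.2 ⟨l, rfl⟩).symm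
  refine ⟨fun k => τ k + l, fun i j hij => by have := hτ hij; simpa using this,
    fun k => ⟨?_, ?_⟩, hM⟩
  · have : τ M.first ≤ τ k := hτ.monotone (Fin.mk_le_of_le_val (Nat.zero_le _))
    have := hc.1
    dsimp only
    linarith
  -- A shifted time from `s₁` on still precedes `c + 1`. The curve is above the line on `[s₁, s₀ +
  -- 1]`, and on the rest because it is a translate of part of `[s₀, c)`.
  · by_contra! h
    have h1 := hτ1 k
    have h2 : (M.curve ((τ k + l : ℝ))).2 = 0 := by rw [hM]
    rcases le_or_gt (τ k + l) (s₀ + 1) with h3 | h3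
    · exact (habove _ ⟨h, h3⟩).ne' h2
    · have h4 := hbefore (τ k + l - 1) ⟨by linarith, by linarith⟩
      rw [AddCircle.coe_sub, AddCircle.coe_period, sub_zero] at h4
      exact h4.ne' h2

/-- The cyclically ordered crossing times on a closed meander curve: the crossing `u` on `I`, the
passing times `B`, the crossing `v` on `J`, and the times `A` along the segment one period later. -/
noncomputable def crossingTime {N : ℕ} (u v : ℝ) (A B : Fin N → ℝ) (k : ℕ) : ℝ :=
  -- The cases `0` and `N + 1` are tested early: truncated subtraction would otherwise put them in
  -- the ranges of `B` and `A`. The fallback `u + 1` is the value at `2 * N + 2`, which closes the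
  -- period.
  if k = 0 then u
  else if h : k - 1 < N then B ⟨k - 1, h⟩
  else if k = N + 1 then v
  else if h : k - (N + 2) < N then A ⟨k - (N + 2), h⟩ + 1
  else u + 1

theorem crossingTime_zero {N : ℕ} (u v : ℝ) (A B : Fin N → ℝ) : crossingTime u v A B 0 = u := rfl

theorem crossingTime_top {N : ℕ} (u v : ℝ) (A B : Fin N → ℝ) (i : Fin N) :
    crossingTime u v A B (i + 1) = B i := by
  simp [crossingTime]

theorem crossingTime_mid {N : ℕ} (u v : ℝ) (A B : Fin N → ℝ) :
    crossingTime u v A B (N + 1) = v := by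
  simp [crossingTime]

theorem crossingTime_bottom {N : ℕ} (u v : ℝ) (A B : Fin N → ℝ) (i : Fin N) :
    crossingTime u v A B (N + 2 + i) = A i + 1 := by
  have h : ¬ (N + 2 + (i : ℕ) - 1 < N) := by omega
  rw [crossingTime, if_neg (by omega), dif_neg h, if_neg (by omega), dif_pos (by omega)]
  simp

theorem crossingTime_last {N : ℕ} (u v : ℝ) (A B : Fin N → ℝ) :
    crossingTime u v A B (2 * N + 2) = u + 1 := by
  have h : ¬ (2 * N + 2 - 1 < N) := by omega
  have h' : 2 * N + 2 ≠ N + 1 := by omega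
  have h'' : ¬ (2 * N + 2 - (N + 2) < N) := by omega
  simp only [crossingTime, h, h', h'', dif_neg, if_false, not_false_eq_true]
  simp

/-- Inside a block this is monotonicity of `A` or `B`; the other hypotheses handle the seams. `huv`
and `hvu` cover `N = 0`, where nothing separates the two crossings. -/
theorem crossingTime_lt {N : ℕ} {u v : ℝ} {A B : Fin N → ℝ} (hA : StrictMono A)
    (hB : StrictMono B) (huB : ∀ i, u < B i) (hBv : ∀ i, B i < v) (huv : u < v)
    (hvA : ∀ i, v < A i + 1) (hAu : ∀ i, A i < u) (hvu : v < u + 1) (k : ℕ)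
    (hk : k < 2 * N + 2) : crossingTime u v A B k < crossingTime u v A B (k + 1) := by
  rcases Nat.eq_zero_or_pos k with rfl | h0
  · rw [crossingTime_zero]
    rcases Nat.eq_zero_or_pos N with rfl | hN
    · rwa [crossingTime_mid]
    · rw [show 0 + 1 = ((⟨0, hN⟩ : Fin N) : ℕ) + 1 from rfl, crossingTime_top]
      exact huB _
  obtain ⟨k, rfl⟩ : ∃ j, k = j + 1 := ⟨k - 1, by omega⟩
  rcases lt_or_ge k N with h1 | h1
  · rw [crossingTime_top u v A B ⟨k, h1⟩]
    rcases eq_or_lt_of_le (Nat.succ_le_of_lt h1) with h2 | h2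
    · rw [← Nat.succ_eq_add_one k, h2, crossingTime_mid]
      exact hBv _
    · rw [crossingTime_top u v A B ⟨k + 1, h2⟩]
      exact hB (Fin.mk_lt_mk.2 k.lt_succ_self)
  rcases eq_or_lt_of_le h1 with rfl | h2
  · rw [crossingTime_mid]
    rcases Nat.eq_zero_or_pos N with rfl | hN
    · have := crossingTime_last u v A B
      simp only [Nat.mul_zero, Nat.zero_add] at this ⊢
      rwa [this]
    · rw [show N + 1 + 1 = N + 2 + ((⟨0, hN⟩ : Fin N) : ℕ) from rfl, crossingTime_bottom]
      exact hvA _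
  obtain ⟨j, rfl⟩ : ∃ j, k = N + 1 + j := ⟨k - (N + 1), by omega⟩
  have hj : j < N := by omega
  rw [show N + 1 + j + 1 = N + 2 + ((⟨j, hj⟩ : Fin N) : ℕ) by simp only; omega,
    crossingTime_bottom]
  rcases eq_or_lt_of_le (Nat.succ_le_of_lt hj) with h3 | h3
  · rw [show N + 2 + j + 1 = 2 * N + 2 by omega, crossingTime_last]
    linarith [hAu ⟨j, hj⟩]
  · rw [show N + 2 + j + 1 = N + 2 + ((⟨j + 1, h3⟩ : Fin N) : ℕ) by simp only; omega,
      crossingTime_bottom]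
    have : A ⟨j, hj⟩ < A ⟨j + 1, h3⟩ := hA (Fin.mk_lt_mk.2 j.lt_succ_self)
    linarith

/-! ### Double points of the closure -/

theorem proposition4p2 {n : ℕ} (M : ClosedMeander n) (μ : Equiv.Perm (Fin (2 * n)))
    (hμ : M.HasPermutation μ) (γ : AddCircle (1 : ℝ) → ℝ × ℝ) (hγ : M.IsClosure γ) :
    IsGenericPlaneCurve γ ∧
      ChordDiagram.Equivalent (permGaussDiagram μ) (gaussDiagram γ) := by
  obtain ⟨hcont, a, b, s₀, s₁, t₀, t₁, t₂, t₃, hab, hs, hs', habove, ⟨c, hc, hcM, hbefore⟩,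
    h01, h12, h23, h34, hγa, hγb, hline, hmono, ⟨φ, hφc, hφm, hφ2, hφ3, hφ⟩, hI, hJ, hIJ,
    ⟨u, hu, v, hv, huvc, huv⟩⟩ := hγ
  obtain ⟨τ, hτ, hτs, hτM⟩ := hμ.exists_times habove hc hcM hbefore
  have hgc : Continuous fun t : ℝ => γ t := hcont.comp (AddCircle.continuous_mk' 1)
  have hA : ∀ i, ∃ t ∈ Ioo t₀ t₁, (γ (t : ℝ)).1 = M.abscissa i := fun i => by
    have := intermediate_value_Ioo h01.le (continuous_fst.comp hgc).continuousOn
    simp only [Function.comp_apply, hγa, hγb] at this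
    exact this (hab i)
  choose A hA01 hAγ using hA
  have hAγ' : ∀ i, γ (A i : ℝ) = (M.abscissa i, 0) := fun i =>
    Prod.ext (hAγ i) (hline _ (Ioo_subset_Icc_self (hA01 i)))
  have hB : ∀ k, ∃ t ∈ Ioo t₂ t₃, φ t = τ k := fun k => by
    have := intermediate_value_Ioo h23.le hφc
    rw [hφ2, hφ3] at this
    exact this (hτs k)
  choose B hB23 hBφ using hB
  have hBγ : ∀ k, γ (B k : ℝ) = (M.abscissa (μ k), 0) := fun k => by
    rw [hφ _ (Ioo_subset_Icc_self (hB23 k)), hBφ, hτM]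
  have hAmono : StrictMono A := fun i j hij => by
    rw [← hmono.lt_iff_lt (Ioo_subset_Icc_self (hA01 i)) (Ioo_subset_Icc_self (hA01 j))]
    simp only [hAγ]
    exact M.strictMono hij
  have hBmono : StrictMono B := fun i j hij => by
    rw [← hφm.lt_iff_lt (Ioo_subset_Icc_self (hB23 i)) (Ioo_subset_Icc_self (hB23 j)), hBφ, hBφ]
    exact hτ hij
  have hφmem : ∀ t ∈ Icc t₂ t₃, φ t ∈ Icc s₀ s₁ := fun t ht => by
    rw [← hφ2, ← hφ3]
    exact ⟨hφm.monotoneOn (left_mem_Icc.2 h23.le) ht ht.1,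
      hφm.monotoneOn ht (right_mem_Icc.2 h23.le) ht.2⟩
  have hseg : ∀ t ∈ Icc t₀ t₁, ∃ x ∈ Icc a b, γ (t : ℝ) = (x, 0) := fun t ht => by
    refine ⟨(γ (t : ℝ)).1, ⟨?_, ?_⟩, Prod.ext rfl (hline t ht)⟩
    · have := hmono.monotoneOn (left_mem_Icc.2 h01.le) ht ht.1
      simpa only [hγa] using this
    · have := hmono.monotoneOn ht (right_mem_Icc.2 h01.le) ht.2
      simpa only [hγb] using this
  -- The cut meander lasts less than one period, so its times are determined as real numbers.
  have hMinj : ∀ s ∈ Icc s₀ s₁, ∀ s' ∈ Icc s₀ s₁, M.curve (s : ℝ) = M.curve (s' : ℝ) → s = s' :=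
    fun s h1 s' h2 h => AddCircle.coe_inj_of_lt_add_one (M.injective h)
      (by linarith [h1.1, h2.2]) (by linarith [h1.2, h2.1])
  -- One period is split into the four pieces. The corners `t₁`, `t₂`, `t₃` are assigned to the
  -- segment or the meander, since `hIJ` speaks only of the open arcs.
  have hreal : ∀ x ∈ Ico t₀ (t₀ + 1), ∀ y ∈ Ico t₀ (t₀ + 1), x < y → γ (x : ℝ) = γ (y : ℝ) →
      (∃ k, x = A (μ k) ∧ y = B k) ∨ (x = u ∧ y = v) := by
    intro x hx y hy hxy h
    rcases le_or_gt x t₁ with hx1 | hx1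
    · have hxs : x ∈ Icc t₀ t₁ := ⟨hx.1, hx1⟩
      obtain ⟨x', hx', hγx⟩ := hseg x hxs
      rcases le_or_gt y t₁ with hy1 | hy1
      · exact absurd (congrArg Prod.fst h) (hmono hxs ⟨hy.1, hy1⟩ hxy).ne
      rcases lt_or_ge y t₂ with hy2 | hy2
      · exact absurd (h.symm.trans hγx) ((hIJ y (Or.inl ⟨hy1, hy2⟩)).1 x' hx')
      rcases le_or_gt y t₃ with hy3 | hy3
      · have hys : y ∈ Icc t₂ t₃ := ⟨hy2, hy3⟩
        have hMy : M.curve (φ y : ℝ) = (x', 0) := by rw [← hφ y hys, ← h, hγx]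
        obtain ⟨i, rfl⟩ := (M.mem_line_iff x').1 ⟨_, hMy⟩
        obtain ⟨k, rfl⟩ := μ.surjective i
        refine Or.inl ⟨k, ?_, ?_⟩
        · refine hmono.injOn hxs (Ioo_subset_Icc_self (hA01 _)) ?_
          simp only [hγx, hAγ]
        · refine hφm.injOn hys (Ioo_subset_Icc_self (hB23 _)) ?_
          rw [hBφ]
          exact hMinj _ (hφmem y hys) _ (Ioo_subset_Icc_self (hτs k)) (hMy.trans (hτM k).symm)
      · exact absurd (h.symm.trans hγx) ((hIJ y (Or.inr ⟨hy3, hy.2⟩)).1 x' hx')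
    rcases lt_or_ge x t₂ with hx2 | hx2
    · have hxI := hIJ x (Or.inl ⟨hx1, hx2⟩)
      rcases lt_or_ge y t₂ with hy2 | hy2
      · exact absurd (hI ⟨hx1.le, hx2.le⟩ ⟨(hx1.trans hxy).le, hy2.le⟩ h) hxy.ne
      rcases le_or_gt y t₃ with hy3 | hy3
      · exact absurd (h.trans (hφ y ⟨hy2, hy3⟩)) (hxI.2 _ (hφmem y ⟨hy2, hy3⟩))
      · exact Or.inr (huv x ⟨hx1.le, hx2.le⟩ y ⟨hy3.le, hy.2.le⟩ h)
    rcases le_or_gt x t₃ with hx3 | hx3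
    · rcases le_or_gt y t₃ with hy3 | hy3
      · have hxs : x ∈ Icc t₂ t₃ := ⟨hx2, hx3⟩
        have hys : y ∈ Icc t₂ t₃ := ⟨hx2.trans hxy.le, hy3⟩
        refine absurd (hφm.injOn hxs hys (hMinj _ (hφmem x hxs) _ (hφmem y hys) ?_)) hxy.ne
        rw [← hφ x hxs, ← hφ y hys, h]
      · exact absurd (h.symm.trans (hφ x ⟨hx2, hx3⟩))
          ((hIJ y (Or.inr ⟨hy3, hy.2⟩)).2 _ (hφmem x ⟨hx2, hx3⟩))
    · exact absurd (hJ ⟨hx3.le, hx.2.le⟩ ⟨(hx3.trans hxy).le, hy.2.le⟩ h) hxy.ne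
  have hcrossAB : ∀ k, CrossTransversally (fun t : ℝ => γ t) (fun t : ℝ => γ t)
      (A (μ k)) (B k) := by
    intro k
    have hAn : Icc t₀ t₁ ∈ 𝓝 (A (μ k)) := Icc_mem_nhds (hA01 _).1 (hA01 _).2
    have hBn : Icc t₂ t₃ ∈ 𝓝 (B k) := Icc_mem_nhds (hB23 k).1 (hB23 k).2
    -- Near the crossing, `γ` is the line reparametrized by its own abscissa and the meander
    -- reparametrized by `φ`.
    refine (M.transversal _ _ (hτM k)).reparam (f := fun t => (γ (t : ℝ)).1) (g := φ)
      (continuous_fst.comp hgc).continuousAt (hAγ _) ⟨_, hAn, hmono.injOn⟩ ?_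
      (hφc.continuousAt hBn) (hBφ k) ⟨_, hBn, hφm.injOn⟩ ?_
    · filter_upwards [hAn] with t ht
      exact Prod.ext rfl (hline t ht)
    · filter_upwards [hBn] with t ht
      exact hφ t ht
  have hplus : ∀ x : ℝ, ((x + 1 : ℝ) : AddCircle (1 : ℝ)) = x := fun x => by
    rw [AddCircle.coe_add, AddCircle.coe_period, add_zero]
  refine generic_and_gaussDiagram_of_times μ hcont (crossingTime u v A B)
    (crossingTime_lt hAmono hBmono (fun i => hu.2.trans (hB23 i).1)
      (fun i => (hB23 i).2.trans hv.1) (by linarith [hu.2, hv.1])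
      (fun i => by linarith [hv.2, (hA01 i).1]) (fun i => (hA01 i).2.trans hu.1)
      (by linarith [hv.2, hu.1]))
    (by rw [crossingTime_last, crossingTime_zero]) ?_ ?_
  · rintro (_ | k)
    · simp only [permChord, crossingTime_zero, crossingTime_mid]
      exact huvc
    · rw [permChord_some]
      simp only [crossingTime_top, crossingTime_bottom]
      -- In the list the meander time comes first and the segment time follows one period late,
      -- hence the swap and the shift.
      exact (hcrossAB k).symm.of_coe_eq rfl (hplus _)
  · have key : ∀ x ∈ Ico t₀ (t₀ + 1), ∀ y ∈ Ico t₀ (t₀ + 1), x < y → γ (x : ℝ) = γ (y : ℝ) →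
        ∃ o, s((x : AddCircle (1 : ℝ)), (y : AddCircle (1 : ℝ))) =
          s((crossingTime u v A B (permChord μ o).1 : AddCircle (1 : ℝ)),
            (crossingTime u v A B (permChord μ o).2 : AddCircle (1 : ℝ))) := by
      intro x hx y hy hxy h
      rcases hreal x hx y hy hxy h with ⟨k, rfl, rfl⟩ | ⟨rfl, rfl⟩
      · refine ⟨some k, ?_⟩
        rw [permChord_some]
        simp only [crossingTime_top, crossingTime_bottom, hplus]
        exact Sym2.eq_swap
      · refine ⟨none, ?_⟩
        simp only [permChord, crossingTime_zero, crossingTime_mid]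
    have hrep : ∀ x : AddCircle (1 : ℝ), ∃ r ∈ Ico t₀ (t₀ + 1), (r : AddCircle (1 : ℝ)) = x :=
      fun x => (AddCircle.coe_image_Ico_eq (1 : ℝ) t₀).ge (mem_univ x)
    intro x y hxy h
    obtain ⟨x, hx, rfl⟩ := hrep x
    obtain ⟨y, hy, rfl⟩ := hrep y
    rcases lt_trichotomy x y with hlt | rfl | hlt
    · exact key x hx y hy hlt h
    · exact absurd rfl hxy
    · rw [Sym2.eq_swap]
      exact key y hy x hx hlt h.symm
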